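/- Consider $n\ge 1$ qubits with Majorana operators $\gamma_{2k-1}=Z_1\cdots Z_{k-1}X_k$ and $\gamma_{2k}=Z_1\cdots Z_{k-1}Y_k$ for $k=1,\dots,n$. For a real orthogonal matrix $Q\in\mathrm{O}(2n)$, a free-fermionic unitary $U_Q$ is a unitary with $U_Q^\dagger\gamma_\mu U_Q=\sum_{\nu=1}^{2n}Q_{\mu\nu}\gamma_\nu$ for all $\mu\in\{1,\dots,2n\}$. A free-fermionic state is a state of the form $U_Q\bigotimes_{j=1}^n\frac{I+\lambda_jZ_j}{2}\,U_Q^\dagger$ with $Q\in\mathrm{O}(2n)$ and $\lambda_j\in[-1,1]$; it is pure if it has rank one. Let $\|A\|_1=\operatorname{Tr}\sqrt{A^\dagger A}$. Let $\varepsilon,\delta\in(0,1)$ and $N=\lceil 32\,(n^3/\varepsilon^2)\log(4n^2/\delta)\rceil$, where $\log$ is the natural logarithm. There exists a learning algorithm, depending only on $n$, $\varepsilon$ and $\delta$, that uses $N$ copies of an unknown $n$-qubit state and only single-copy measurements (each copy is measured separately by a POVM, and the output is a function of the $N$ outcomes), such that for every pure free-fermionic state $\psi$ the following holds. On copies of $\psi$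 the algorithm outputs, as an efficient classical representation, a real orthogonal $2n\times 2n$ matrix $\hat Q$, and with probability at least $1-\delta$ the pure free-fermionic state $\hat\psi=U_{\hat Q}|0^n\rangle\langle 0^n|U_{\hat Q}^\dagger$ that it represents satisfies $\|\hat\psi-\psi\|_1\le\varepsilon$. -/

import Mathlib

open scoped Matrix ComplexOrder

noncomputable section

namespace FreeFermion

/-! ## Qubits, Pauli matrices and Majorana operators -/

/-- Linear operators on `n` qubits, as matrices in the computational basis. The basis vectors
are the bit strings `x : Fin n → Fin 2`. -/
abbrev Op (n : ℕ) : Type := Matrix (Fin n → Fin 2) (Fin n → Fin 2) ℂ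

/-- The tensor product `A 0 ⊗ A 1 ⊗ ⋯ ⊗ A (n - 1)` of single-qubit operators. -/
def tensor {n : ℕ} (A : Fin n → Matrix (Fin 2) (Fin 2) ℂ) : Op n :=
  Matrix.of fun x y => ∏ j, A j (x j) (y j)

/-- The Pauli matrix `X`. -/
def pauliX : Matrix (Fin 2) (Fin 2) ℂ := !![0, 1; 1, 0]

/-- The Pauli matrix `Y`. -/
def pauliY : Matrix (Fin 2) (Fin 2) ℂ := !![0, -Complex.I; Complex.I, 0]

/-- The Pauli matrix `Z`. -/
def pauliZ : Matrix (Fin 2) (Fin 2) ℂ := !![1, 0; 0, -1]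

/-- The `2 n` indices of the Majorana operators. With modes counted from `1`, the pair `(k, 0)`
stands for the index `2 k - 1` and the pair `(k, 1)` for the index `2 k`. -/
abbrev MajIdx (n : ℕ) : Type := Fin n × Fin 2

/-- The Majorana operators: `(∏_{j < k} Z_j) X_k` for the index `(k, 0)` and
`(∏_{j < k} Z_j) Y_k` for the index `(k, 1)`. -/
def majorana {n : ℕ} (μ : MajIdx n) : Op n :=
  tensor fun j =>
    if j < μ.1 then pauliZ
    else if j = μ.1 then (if μ.2 = 0 then pauliX else pauliY)
    else 1

/-! ## Free-fermionic unitaries and states -/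

/-- `U` is a free-fermionic unitary `U_Q` associated with the real matrix `Q`:
`U† γ_μ U = ∑_ν Q_{μν} γ_ν` for all `μ`. -/
def IsFreeFermionicUnitary {n : ℕ} (Q : Matrix (MajIdx n) (MajIdx n) ℝ) (U : Op n) : Prop :=
  U ∈ Matrix.unitaryGroup (Fin n → Fin 2) ℂ ∧
    ∀ μ, Uᴴ * majorana μ * U = ∑ ν, (Q μ ν : ℂ) • majorana ν

/-- `ρ` is a (possibly mixed) free-fermionic state: `ρ = U_Q (⨂_j (I + lam_j Z_j) / 2) U_Q†`
with `Q` a real orthogonal `2n × 2n` matrix and `lam_j ∈ [-1, 1]`. -/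
def IsFreeFermionicState {n : ℕ} (ρ : Op n) : Prop :=
  ∃ Q ∈ Matrix.orthogonalGroup (MajIdx n) ℝ, ∃ U : Op n, IsFreeFermionicUnitary Q U ∧
    ∃ lam : Fin n → ℝ, (∀ j, |lam j| ≤ 1) ∧
      ρ = U * tensor (fun j => (1 / 2 : ℂ) • (1 + (lam j : ℂ) • pauliZ)) * Uᴴ

/-- `ρ` is a pure free-fermionic state: a free-fermionic state of rank one. -/
def IsPureFreeFermionicState {n : ℕ} (ρ : Op n) : Prop :=
  IsFreeFermionicState ρ ∧ ρ.rank = 1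

/-- The projector `|0ⁿ⟩⟨0ⁿ|`. -/
def zeroState (n : ℕ) : Op n := Matrix.single 0 0 1

/-- The orthogonal matrix `Q` is a classical representation of the state `σ`, namely
`σ = U_Q |0ⁿ⟩⟨0ⁿ| U_Q†`. -/
def Represents {n : ℕ} (Q : Matrix.orthogonalGroup (MajIdx n) ℝ) (σ : Op n) : Prop :=
  ∃ U : Op n, IsFreeFermionicUnitary (Q : Matrix (MajIdx n) (MajIdx n) ℝ) U ∧
    σ = U * zeroState n * Uᴴ

/-- The Schatten one-norm `‖A‖₁ = Tr √(A† A)`: the sum of the singular values of `A`, which are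
the square roots of the eigenvalues of `A† A`. -/
def schattenOneNorm {n : ℕ} (A : Op n) : ℝ :=
  ∑ x, √((Matrix.isHermitian_conjTranspose_mul_self A).eigenvalues x)

/-! ## Learning algorithms with single-copy measurements -/

/-- A measurement (POVM) with finite outcome set `Ω` on one copy of an `n`-qubit state. -/
structure Povm (n : ℕ) (Ω : Type) [Fintype Ω] where
  /-- The effect of each outcome. -/
  effect : Ω → Op n
  posSemidef : ∀ a, (effect a).PosSemidef
  sum_eq_one : ∑ a, effect a = 1

/-- The Born probability `Tr (E_a ρ)` of the outcome `a`. -/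
def Povm.born {n : ℕ} {Ω : Type} [Fintype Ω] (M : Povm n Ω) (ρ : Op n) (a : Ω) : ℝ :=
  (M.effect a * ρ).trace.re

/-- A learning algorithm that uses `N` copies of an unknown `n`-qubit state and single-copy
measurements only. The `i`-th copy is measured on its own with the POVM `meas i`, which is
fixed in advance (so the measurements are neither joint nor adaptive). The classical output is a
deterministic function of the `N` outcomes and consists of a real orthogonal `2n × 2n` matrix. -/
structure SingleCopyLearner (n N : ℕ) where
  /-- The set of outcomes of the measurements. -/
  Outcome : Type
  [fintypeOutcome : Fintype Outcome]
  /-- The measurement of each copy. -/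
  meas : Fin N → Povm n Outcome
  /-- The classical post-processing of the outcomes. -/
  output : (Fin N → Outcome) → Matrix.orthogonalGroup (MajIdx n) ℝ

attribute [instance] SingleCopyLearner.fintypeOutcome

open Classical in
/-- The probability that the tuple of outcomes lies in `S` when the `N` copies are in the
state `ρ`. As the copies are independent and measured separately, a tuple of outcomes has the
product of the Born probabilities. -/
def SingleCopyLearner.prob {n N : ℕ} (A : SingleCopyLearner n N) (ρ : Op n)
    (S : Set (Fin N → A.Outcome)) : ℝ :=
  ∑ w : Fin N → A.Outcome with w ∈ S, ∏ i, (A.meas i).born ρ (w i)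

end FreeFermion

end

noncomputable section

namespace FreeFermion

/-! ## Tensor products -/

/-! A pure free-fermionic state is determined by its correlation matrix, the expectations of the
Hermitian bilinears `-i γ_μ γ_ν`; for `U_Q |0ⁿ⟩` this matrix is `cov Q`. The proof makes this
determination quantitative and then estimates the matrix by sampling.

Stability. Applying `V†` reduces the comparison of `U|0ⁿ⟩` and `V|0ⁿ⟩` to that of `W|0ⁿ⟩`, `W =
V†U`, with the vacuum. The Hamiltonian `∑ (1 - Z_k)` vanishes on the vacuum and is at least 2 on
every other basis state, so twice the infidelity is at most the energy of `W|0ⁿ⟩`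
(`one_sub_normSq_le`). That energy is a quarter of the squared Frobenius distance of the correlation
matrices (`sum_sq_vacuumCov_sub_cov`). Together with `‖P - S‖₁ = 2 √(1 - F)` for rank-one projectors
of overlap `F`, a squared Frobenius distance of at most `2 ε²` forces trace distance at most `ε`
(`schattenOneNorm_sub_le`).

Sampling. Index the Majoranas by the abelian group `ℤ/n × ℤ/2`. Bilinears with the same sum `μ + ν`
sit on disjoint or equal pairs, hence commute and share one projective measurement
(`exists_povm_bilinear`). There are `2n` classes, so each receives at least `⌊N / 2n⌋` copies.
Hoeffding's inequality and a union bound over the `4n²` ordered pairs give, with probability at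
least `1 - δ`, squared Frobenius error at most `ε² / 2` (`covLearner_prob`).

Rounding. The output is any `Q̂`, realizable by a unitary, whose correlation matrix is within `ε² /
2` of the empirical one. The true `Q` is a candidate, so one exists on the good event, and `(a + b)²
≤ 2a² + 2b²` puts `cov Q̂` within `2 ε²` of `cov Q`. -/

lemma tensor_mul {n : ℕ} (A B : Fin n → Matrix (Fin 2) (Fin 2) ℂ) :
    tensor A * tensor B = tensor fun j => A j * B j := by
  ext x y
  simp only [tensor, Matrix.mul_apply, Matrix.of_apply, Fintype.prod_sum, Finset.prod_mul_distrib]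

lemma tensor_one {n : ℕ} : tensor (fun _ : Fin n => (1 : Matrix (Fin 2) (Fin 2) ℂ)) = 1 := by
  ext x y
  by_cases h : x = y
  · subst h; simp [tensor]
  · obtain ⟨j, hj⟩ := Function.ne_iff.1 h
    simp only [tensor, Matrix.of_apply, Matrix.one_apply, if_neg h]
    exact Finset.prod_eq_zero (Finset.mem_univ j) (by simp [hj])

lemma conjTranspose_tensor {n : ℕ} (A : Fin n → Matrix (Fin 2) (Fin 2) ℂ) :
    (tensor A)ᴴ = tensor fun j => (A j)ᴴ := by
  ext x y
  simp [tensor, Matrix.conjTranspose_apply]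

lemma tensor_smul {n : ℕ} (s : Fin n → ℂ) (A : Fin n → Matrix (Fin 2) (Fin 2) ℂ) :
    tensor (fun j => s j • A j) = (∏ j, s j) • tensor A := by
  ext x y
  simp [tensor, Finset.prod_mul_distrib]

lemma tensor_diagonal {n : ℕ} (d : Fin n → Fin 2 → ℂ) :
    tensor (fun j => Matrix.diagonal (d j)) = Matrix.diagonal fun x => ∏ j, d j (x j) := by
  ext x y
  by_cases h : x = y
  · subst h; simp [tensor]
  · obtain ⟨j, hj⟩ := Function.ne_iff.1 h
    rw [Matrix.diagonal_apply_ne _ h]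
    exact Finset.prod_eq_zero (Finset.mem_univ j) (by simp [hj])

/-! ## Pauli matrices -/

lemma pauliX_mul_self : pauliX * pauliX = 1 := by
  ext i j; fin_cases i <;> fin_cases j <;> simp [pauliX]

lemma pauliY_mul_self : pauliY * pauliY = 1 := by
  ext i j; fin_cases i <;> fin_cases j <;> simp [pauliY]

lemma pauliZ_mul_self : pauliZ * pauliZ = 1 := by
  ext i j; fin_cases i <;> fin_cases j <;> simp [pauliZ]

lemma conjTranspose_pauliX : pauliXᴴ = pauliX := by
  ext i j; fin_cases i <;> fin_cases j <;> simp [pauliX]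

lemma conjTranspose_pauliY : pauliYᴴ = pauliY := by
  ext i j; fin_cases i <;> fin_cases j <;> simp [pauliY]

lemma conjTranspose_pauliZ : pauliZᴴ = pauliZ := by
  ext i j; fin_cases i <;> fin_cases j <;> simp [pauliZ]

lemma pauliX_mul_pauliY : pauliX * pauliY = -(pauliY * pauliX) := by
  ext i j; fin_cases i <;> fin_cases j <;> simp [pauliX, pauliY]

lemma pauliX_mul_pauliZ : pauliX * pauliZ = -(pauliZ * pauliX) := by
  ext i j; fin_cases i <;> fin_cases j <;> simp [pauliX, pauliZ]

lemma pauliY_mul_pauliZ : pauliY * pauliZ = -(pauliZ * pauliY) := by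
  ext i j; fin_cases i <;> fin_cases j <;> simp [pauliY, pauliZ]

lemma pauliX_mul_pauliY_eq : pauliX * pauliY = Complex.I • pauliZ := by
  ext i j; fin_cases i <;> fin_cases j <;> simp [pauliX, pauliY, pauliZ]

lemma pauliZ_eq_diagonal : pauliZ = Matrix.diagonal ![1, -1] := by
  ext i j; fin_cases i <;> fin_cases j <;> simp [pauliZ]

/-! ## The Majorana operators -/

variable {n : ℕ}

lemma conjTranspose_majorana (μ : MajIdx n) : (majorana μ)ᴴ = majorana μ := by
  rw [majorana, conjTranspose_tensor]
  congr 1; funext j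
  split_ifs <;> simp [conjTranspose_pauliX, conjTranspose_pauliY, conjTranspose_pauliZ]

lemma majorana_mul_self (μ : MajIdx n) : majorana μ * majorana μ = 1 := by
  rw [majorana, tensor_mul, ← tensor_one]
  congr 1; funext j
  split_ifs <;> simp [pauliX_mul_self, pauliY_mul_self, pauliZ_mul_self]

/-- The tensor factors commute at every site except `μ.1`, where two distinct Pauli matrices meet;
that single site supplies the sign. -/
lemma majorana_anticomm_of_le {μ ν : MajIdx n} (h : μ ≠ ν) (hle : μ.1 ≤ ν.1) :
    majorana μ * majorana ν = -(majorana ν * majorana μ) := by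
  have key : ∀ A B : Fin n → Matrix (Fin 2) (Fin 2) ℂ,
      (∀ j, A j * B j = (if j = μ.1 then (-1 : ℂ) else 1) • (B j * A j)) →
      tensor A * tensor B = -(tensor B * tensor A) := by
    intro A B hAB
    rw [tensor_mul, tensor_mul, funext hAB, tensor_smul]
    simp
  apply key
  intro j
  obtain ⟨k, a⟩ := μ
  obtain ⟨l, b⟩ := ν
  dsimp only at hle ⊢
  rcases lt_trichotomy j k with hj | rfl | hj
  · simp [hj, hj.trans_le hle, hj.ne]
  · rcases hle.lt_or_eq with hl | rfl
    · simp only [lt_irrefl, if_true, if_false, hl]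
      split_ifs <;> simp [pauliX_mul_pauliZ, pauliY_mul_pauliZ]
    · have hab : a ≠ b := fun e => h (by rw [e])
      fin_cases a <;> fin_cases b <;> simp_all [pauliX_mul_pauliY]
  · simp [hj.not_gt, hj.ne']

lemma majorana_anticomm {μ ν : MajIdx n} (h : μ ≠ ν) :
    majorana μ * majorana ν = -(majorana ν * majorana μ) := by
  rcases le_total μ.1 ν.1 with hle | hle
  · exact majorana_anticomm_of_le h hle
  · rw [majorana_anticomm_of_le h.symm hle, neg_neg]

/-- The Hermitian Majorana bilinear `-i γ_μ γ_ν`. -/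
def bilinear (μ ν : MajIdx n) : Op n := (-Complex.I) • (majorana μ * majorana ν)

lemma isHermitian_bilinear {μ ν : MajIdx n} (h : μ ≠ ν) : (bilinear μ ν).IsHermitian := by
  rw [Matrix.IsHermitian, bilinear, Matrix.conjTranspose_smul, Matrix.conjTranspose_mul,
    conjTranspose_majorana, conjTranspose_majorana, majorana_anticomm h]
  simp

lemma bilinear_swap {μ ν : MajIdx n} (h : μ ≠ ν) : bilinear ν μ = -bilinear μ ν := by
  rw [bilinear, bilinear, majorana_anticomm h]; simp

lemma bilinear_mul_self {μ ν : MajIdx n} (h : μ ≠ ν) : bilinear μ ν * bilinear μ ν = 1 := by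
  have : majorana μ * majorana ν * (majorana μ * majorana ν) = -1 := by
    calc majorana μ * majorana ν * (majorana μ * majorana ν)
        = majorana μ * (majorana ν * majorana μ) * majorana ν := by simp only [mul_assoc]
      _ = -((majorana μ * majorana μ) * (majorana ν * majorana ν)) := by
        rw [majorana_anticomm h.symm]; simp only [mul_assoc, mul_neg, neg_mul]
      _ = -1 := by rw [majorana_mul_self, majorana_mul_self, mul_one]
  rw [bilinear, smul_mul_smul_comm, this]
  simp

lemma commute_bilinear_majorana {μ ν ρ : MajIdx n} (h₁ : μ ≠ ρ) (h₂ : ν ≠ ρ) :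
    Commute (bilinear μ ν) (majorana ρ) := by
  refine Commute.smul_left ?_ _
  rw [Commute, SemiconjBy, mul_assoc, majorana_anticomm h₂, mul_neg, ← mul_assoc,
    majorana_anticomm h₁, neg_mul, neg_neg, mul_assoc]

/-- Bilinears attached to disjoint or equal pairs of indices commute. -/
lemma commute_bilinear {μ ν μ' ν' : MajIdx n} (h : μ ≠ ν)
    (hd : (μ = μ' ∧ ν = ν') ∨ (μ = ν' ∧ ν = μ') ∨ (μ ≠ μ' ∧ μ ≠ ν' ∧ ν ≠ μ' ∧ ν ≠ ν')) :
    Commute (bilinear μ ν) (bilinear μ' ν') := by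
  rcases hd with ⟨rfl, rfl⟩ | ⟨rfl, rfl⟩ | ⟨h₁, h₂, h₃, h₄⟩
  · exact Commute.refl _
  · rw [bilinear_swap h]; exact (Commute.refl _).neg_right
  · exact Commute.smul_right
      ((commute_bilinear_majorana h₁ h₃).mul_right (commute_bilinear_majorana h₂ h₄)) _

/-! ## Covariance matrices -/

/-- The correlation matrix of the vacuum. -/
def vacuumCov (n : ℕ) : Matrix (MajIdx n) (MajIdx n) ℝ :=
  Matrix.of fun μ ν => (bilinear μ ν 0 0).re

/-- The correlation matrix of the free-fermionic state `U_Q |0ⁿ⟩⟨0ⁿ| U_Q†`. -/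
def cov (Q : Matrix (MajIdx n) (MajIdx n) ℝ) : Matrix (MajIdx n) (MajIdx n) ℝ :=
  Q * vacuumCov n * Qᵀ

lemma bilinear_self (μ : MajIdx n) : bilinear μ μ = (-Complex.I) • 1 := by
  rw [bilinear, majorana_mul_self]

lemma vacuumCov_transpose : (vacuumCov n)ᵀ = -vacuumCov n := by
  ext μ ν
  simp only [vacuumCov, Matrix.transpose_apply, Matrix.of_apply, Matrix.neg_apply]
  by_cases h : μ = ν
  · subst h; simp [bilinear_self]
  · rw [bilinear_swap h]; simp

lemma cov_transpose (Q : Matrix (MajIdx n) (MajIdx n) ℝ) : (cov Q)ᵀ = -cov Q := by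
  rw [cov, Matrix.transpose_mul, Matrix.transpose_mul, vacuumCov_transpose]
  simp [mul_assoc]

lemma cov_swap (Q : Matrix (MajIdx n) (MajIdx n) ℝ) (μ ν : MajIdx n) :
    cov Q ν μ = -cov Q μ ν := by
  simpa using congrFun (congrFun (cov_transpose Q) μ) ν

/-- At site `ν.1` only the second operator acts, by `X` or `Y`, whose diagonal is zero. -/
lemma vacuumCov_apply_of_lt {μ ν : MajIdx n} (h : μ.1 < ν.1) : vacuumCov n μ ν = 0 := by
  have : (majorana μ * majorana ν) 0 0 = 0 := by
    rw [majorana, majorana, tensor_mul]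
    refine Finset.prod_eq_zero (Finset.mem_univ ν.1) ?_
    simp only [h.not_gt, h.ne', lt_irrefl, if_true, if_false]
    split_ifs <;> simp [pauliX, pauliY]
  simp [vacuumCov, bilinear, this]

/-- The `Z` strings cancel and `-i X Y = Z`, so this bilinear is `Z_k`. -/
lemma bilinear_pair (k : Fin n) :
    bilinear (k, 0) (k, 1) = Matrix.diagonal fun x => (![1, -1] (x k) : ℂ) := by
  have h : majorana (k, 0) * majorana (k, 1) =
      Complex.I • tensor (fun j => Matrix.diagonal (if j = k then ![1, -1] else 1)) := by
    have : ∏ j : Fin n, (if j = k then Complex.I else 1) = Complex.I := by simp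
    rw [majorana, majorana, tensor_mul, ← this, ← tensor_smul]
    congr 1; funext j
    rcases lt_trichotomy j k with hj | rfl | hj
    · simp [hj, hj.ne, pauliZ_mul_self, Pi.one_def]
    · simp [pauliX_mul_pauliY_eq, pauliZ_eq_diagonal]
    · simp [hj.not_gt, hj.ne', Pi.one_def]
  rw [bilinear, h, tensor_diagonal, smul_smul]
  simp only [neg_mul, Complex.I_mul_I, neg_neg, one_smul]
  congr 1; funext x
  rw [Finset.prod_eq_single k] <;> simp +contextual

lemma vacuumCov_apply_pair (k : Fin n) : vacuumCov n (k, 0) (k, 1) = 1 := by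
  simp [vacuumCov, bilinear_pair]

/-- Pairing an antisymmetric matrix with the vacuum correlation matrix. -/
lemma sum_vacuumCov_mul {M : Matrix (MajIdx n) (MajIdx n) ℝ} (hM : Mᵀ = -M) :
    ∑ μ, ∑ ν, vacuumCov n μ ν * M μ ν = 2 * ∑ k, M (k, 0) (k, 1) := by
  have hV : ∀ μ ν, vacuumCov n μ ν = -vacuumCov n ν μ := fun μ ν => by
    simpa using congrFun (congrFun (vacuumCov_transpose (n := n)) ν) μ
  have hM' : ∀ μ ν, M μ ν = -M ν μ := fun μ ν => by simpa using congrFun (congrFun hM ν) μ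
  -- The vacuum matrix is block diagonal with one `2 × 2` antisymmetric block per mode; the two
  -- off-diagonal entries contribute equally, whence the factor 2.
  have h0 : ∀ μ ν : MajIdx n, μ.1 ≠ ν.1 → vacuumCov n μ ν = 0 := fun μ ν h => by
    rcases lt_or_gt_of_ne h with h | h
    · exact vacuumCov_apply_of_lt h
    · rw [hV, vacuumCov_apply_of_lt h, neg_zero]
  rw [Fintype.sum_prod_type, Finset.mul_sum]
  refine Finset.sum_congr rfl fun k _ => ?_
  rw [Finset.sum_congr rfl fun a _ => Fintype.sum_prod_type _]
  rw [Finset.sum_congr rfl fun a _ => Finset.sum_eq_single k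
    (fun l _ hl => Finset.sum_eq_zero fun b _ => by rw [h0 _ _ hl.symm, zero_mul]) (by simp)]
  have hd : ∀ a, vacuumCov n (k, a) (k, a) = 0 := fun a => by linarith [hV (k, a) (k, a)]
  simp only [Fin.sum_univ_two, hd, vacuumCov_apply_pair, hV (k, 1) (k, 0), hM' (k, 1) (k, 0)]
  ring

lemma vacuumCov_mul_self_sum : ∑ μ, ∑ ν, vacuumCov n μ ν ^ 2 = 2 * n := by
  simp only [sq]
  rw [sum_vacuumCov_mul vacuumCov_transpose]
  simp [vacuumCov_apply_pair]

lemma sum_sq_eq_trace {m : Type*} [Fintype m] (A : Matrix m m ℝ) :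
    ∑ μ, ∑ ν, A μ ν ^ 2 = (Aᵀ * A).trace := by
  simp only [Matrix.trace, Matrix.diag, Matrix.mul_apply, Matrix.transpose_apply, sq]
  exact Finset.sum_comm

/-- The Frobenius norm is invariant under orthogonal conjugation. -/
lemma sum_sq_conj {m : Type*} [Fintype m] [DecidableEq m] {Q : Matrix m m ℝ}
    (hQ : Q ∈ Matrix.orthogonalGroup m ℝ) (A : Matrix m m ℝ) :
    ∑ μ, ∑ ν, (Q * A * Qᵀ) μ ν ^ 2 = ∑ μ, ∑ ν, A μ ν ^ 2 := by
  have h : Qᵀ * Q = 1 := (Matrix.mem_orthogonalGroup_iff' m ℝ).1 hQ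
  rw [sum_sq_eq_trace, sum_sq_eq_trace]
  calc ((Q * A * Qᵀ)ᵀ * (Q * A * Qᵀ)).trace = (Q * (Aᵀ * (Qᵀ * Q) * A * Qᵀ)).trace := by
        simp only [Matrix.transpose_mul, Matrix.transpose_transpose, mul_assoc]
    _ = (Aᵀ * A * (Qᵀ * Q)).trace := by
        rw [h, Matrix.trace_mul_comm, mul_one, mul_assoc _ Qᵀ, h]
    _ = _ := by rw [h, mul_one]

/-! ## Free-fermionic unitaries -/

lemma IsFreeFermionicUnitary.conj_bilinear {Q : Matrix (MajIdx n) (MajIdx n) ℝ} {U : Op n}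
    (h : IsFreeFermionicUnitary Q U) (μ ν : MajIdx n) :
    Uᴴ * bilinear μ ν * U = ∑ a, ∑ b, ((Q μ a * Q ν b : ℝ) : ℂ) • bilinear a b := by
  have hU : U * Uᴴ = 1 := (Matrix.mem_unitaryGroup_iff).1 h.1
  calc Uᴴ * bilinear μ ν * U
      = (-Complex.I) • (Uᴴ * majorana μ * (U * Uᴴ) * majorana ν * U) := by
        rw [hU, bilinear]; simp only [mul_one, Matrix.mul_smul, Matrix.smul_mul, mul_assoc]
    _ = (-Complex.I) • ((Uᴴ * majorana μ * U) * (Uᴴ * majorana ν * U)) := by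
        simp only [mul_assoc]
    _ = _ := by
        rw [h.2, h.2, Finset.sum_mul_sum, Finset.smul_sum]
        refine Finset.sum_congr rfl fun a _ => ?_
        rw [Finset.smul_sum]
        refine Finset.sum_congr rfl fun b _ => ?_
        rw [bilinear, smul_mul_smul_comm, smul_comm, Complex.ofReal_mul]

lemma cov_apply (Q : Matrix (MajIdx n) (MajIdx n) ℝ) (μ ν : MajIdx n) :
    cov Q μ ν = ∑ a, ∑ b, Q μ a * Q ν b * vacuumCov n a b := by
  simp only [cov, Matrix.mul_apply, Matrix.transpose_apply, Finset.sum_mul]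
  rw [Finset.sum_comm]
  exact Finset.sum_congr rfl fun a _ => Finset.sum_congr rfl fun b _ => by ring

/-- The correlation matrix of `U_Q |0ⁿ⟩⟨0ⁿ| U_Q†` in terms of expectation values. -/
lemma IsFreeFermionicUnitary.re_conj_bilinear {Q : Matrix (MajIdx n) (MajIdx n) ℝ} {U : Op n}
    (h : IsFreeFermionicUnitary Q U) (μ ν : MajIdx n) :
    ((Uᴴ * bilinear μ ν * U) 0 0).re = cov Q μ ν := by
  rw [h.conj_bilinear, cov_apply]
  simp only [Matrix.sum_apply, Matrix.smul_apply, Complex.re_sum, smul_eq_mul,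
    Complex.re_ofReal_mul, vacuumCov, Matrix.of_apply]

lemma IsFreeFermionicUnitary.mul {Q R : Matrix (MajIdx n) (MajIdx n) ℝ} {U V : Op n}
    (hV : IsFreeFermionicUnitary R V) (hU : IsFreeFermionicUnitary Q U) :
    IsFreeFermionicUnitary (R * Q) (V * U) := by
  refine ⟨mul_mem hV.1 hU.1, fun μ => ?_⟩
  calc (V * U)ᴴ * majorana μ * (V * U) = Uᴴ * (Vᴴ * majorana μ * V) * U := by
        simp only [Matrix.conjTranspose_mul, mul_assoc]
    _ = ∑ a, (R μ a : ℂ) • (Uᴴ * majorana a * U) := by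
        rw [hV.2, Finset.mul_sum, Finset.sum_mul]
        simp only [Matrix.mul_smul, Matrix.smul_mul]
    _ = _ := by
        simp only [hU.2, Finset.smul_sum, smul_smul]
        rw [Finset.sum_comm]
        refine Finset.sum_congr rfl fun b _ => ?_
        rw [← Finset.sum_smul, Matrix.mul_apply]
        push_cast
        rfl

lemma IsFreeFermionicUnitary.conjTranspose {R : Matrix (MajIdx n) (MajIdx n) ℝ} {V : Op n}
    (hR : R ∈ Matrix.orthogonalGroup (MajIdx n) ℝ) (hV : IsFreeFermionicUnitary R V) :
    IsFreeFermionicUnitary Rᵀ Vᴴ := by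
  have h1 : V * Vᴴ = 1 := (Matrix.mem_unitaryGroup_iff).1 hV.1
  have hR' : Rᵀ * R = 1 := (Matrix.mem_orthogonalGroup_iff' _ ℝ).1 hR
  refine ⟨Unitary.star_mem hV.1, fun μ => ?_⟩
  have key : Vᴴ * (∑ ν, (Rᵀ μ ν : ℂ) • majorana ν) * V = majorana μ := by
    rw [Finset.mul_sum, Finset.sum_mul]
    simp only [Matrix.mul_smul, Matrix.smul_mul, hV.2, Finset.smul_sum, smul_smul]
    rw [Finset.sum_comm]
    have : ∀ b, ∑ a, ((Rᵀ μ a : ℂ) * (R a b : ℂ)) • majorana b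
        = (((Rᵀ * R) μ b : ℝ) : ℂ) • (majorana b : Op n) := fun b => by
      rw [← Finset.sum_smul, Matrix.mul_apply]
      push_cast
      rfl
    rw [Finset.sum_congr rfl fun b _ => this b, hR', Finset.sum_eq_single μ] <;>
      simp +contextual [eq_comm]
  rw [Matrix.conjTranspose_conjTranspose, ← key]
  calc V * (Vᴴ * (∑ ν, (Rᵀ μ ν : ℂ) • majorana ν) * V) * Vᴴ
      = (V * Vᴴ) * (∑ ν, (Rᵀ μ ν : ℂ) • majorana ν) * (V * Vᴴ) := by simp only [mul_assoc]
    _ = _ := by rw [h1, one_mul, mul_one]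

/-! ## Fidelity and correlation matrices -/

lemma conjTranspose_mul_diagonal_mul_apply {m : Type*} [Fintype m] [DecidableEq m]
    (W : Matrix m m ℂ) (d : m → ℂ) (i : m) :
    (Wᴴ * Matrix.diagonal d * W) i i = ∑ x, d x * (Complex.normSq (W x i) : ℂ) := by
  rw [Matrix.mul_apply]
  refine Finset.sum_congr rfl fun x _ => ?_
  rw [Matrix.mul_diagonal, Matrix.conjTranspose_apply, Complex.normSq_eq_conj_mul_self]
  simp only [RCLike.star_def]
  ring

lemma sum_normSq_col {m : Type*} [Fintype m] [DecidableEq m] {W : Matrix m m ℂ}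
    (hW : W ∈ Matrix.unitaryGroup m ℂ) (i : m) : ∑ x, Complex.normSq (W x i) = 1 := by
  have h := conjTranspose_mul_diagonal_mul_apply W 1 i
  rw [Matrix.diagonal_one', mul_one,
    show Wᴴ * W = 1 from (Matrix.mem_unitaryGroup_iff').1 hW] at h
  simp only [Matrix.one_apply_eq, Pi.one_apply, one_mul] at h
  exact_mod_cast h.symm

/-- The vacuum has zero energy and all other occupation states have energy at least one. -/
lemma one_sub_normSq_le {M : Matrix (MajIdx n) (MajIdx n) ℝ} {W : Op n}
    (hW : IsFreeFermionicUnitary M W) :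
    2 * (1 - Complex.normSq (W 0 0)) ≤ ∑ k, (1 - cov M (k, 0) (k, 1)) := by
  have hsum := sum_normSq_col hW.1 0
  have hcov : ∀ k : Fin n, cov M (k, 0) (k, 1)
      = ∑ x : Fin n → Fin 2, (![1, -1] (x k) : ℝ) * Complex.normSq (W x 0) := fun k => by
    rw [← hW.re_conj_bilinear, bilinear_pair, conjTranspose_mul_diagonal_mul_apply,
      Complex.re_sum]
    refine Finset.sum_congr rfl fun x _ => ?_
    rw [Complex.re_mul_ofReal]
    generalize x k = a
    fin_cases a <;> simp
  -- Both sides become averages over the distribution `|W x 0|²` of bit strings, so a pointwise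
  -- comparison in `x` suffices.
  have h1 : ∑ k, (1 - cov M (k, 0) (k, 1)) =
      ∑ x : Fin n → Fin 2, (∑ k, (1 - (![1, -1] (x k) : ℝ))) * Complex.normSq (W x 0) := by
    simp only [Finset.sum_mul]
    rw [Finset.sum_comm]
    refine Finset.sum_congr rfl fun k _ => ?_
    rw [hcov]
    simp only [sub_mul, one_mul, Finset.sum_sub_distrib, hsum]
  have h2 : 2 * (1 - Complex.normSq (W 0 0)) =
      ∑ x : Fin n → Fin 2, (if x = 0 then 0 else 2) * Complex.normSq (W x 0) := by
    have : ∀ x : Fin n → Fin 2, (if x = 0 then 0 else 2) * Complex.normSq (W x 0) =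
        2 * Complex.normSq (W x 0) - if x = 0 then 2 * Complex.normSq (W x 0) else 0 :=
      fun x => by split_ifs <;> ring
    rw [Finset.sum_congr rfl fun x _ => this x, Finset.sum_sub_distrib, ← Finset.mul_sum, hsum]
    simp
    ring
  rw [h1, h2]
  refine Finset.sum_le_sum fun x _ => mul_le_mul_of_nonneg_right ?_ (Complex.normSq_nonneg _)
  have hn : ∀ a : Fin 2, (0 : ℝ) ≤ 1 - ![1, -1] a := fun a => by
    fin_cases a <;> norm_num
  split_ifs with hx
  · exact Finset.sum_nonneg fun k _ => hn _
  · obtain ⟨k, hk⟩ := Function.ne_iff.1 hx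
    refine le_trans ?_ (Finset.single_le_sum (fun k _ => hn (x k)) (Finset.mem_univ k))
    have : x k = 1 := by
      generalize x k = a at hk
      fin_cases a <;> simp_all
    rw [this]
    norm_num

/-- Both matrices have squared Frobenius norm `2n`, so only the cross term depends on `M`, and it
sees only the entries paired by the vacuum. -/
lemma sum_sq_vacuumCov_sub_cov {M : Matrix (MajIdx n) (MajIdx n) ℝ}
    (hM : M ∈ Matrix.orthogonalGroup (MajIdx n) ℝ) :
    ∑ μ, ∑ ν, (vacuumCov n μ ν - cov M μ ν) ^ 2 = 4 * ∑ k, (1 - cov M (k, 0) (k, 1)) := by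
  have h : ∀ μ ν, (vacuumCov n μ ν - cov M μ ν) ^ 2 = vacuumCov n μ ν ^ 2 + cov M μ ν ^ 2
      - 2 * (vacuumCov n μ ν * cov M μ ν) := fun μ ν => by ring
  simp only [h, Finset.sum_sub_distrib, Finset.sum_add_distrib, ← Finset.mul_sum]
  rw [sum_vacuumCov_mul (cov_transpose M), cov, sum_sq_conj hM, vacuumCov_mul_self_sum]
  simp
  ring

/-- The infidelity of two pure free-fermionic states is at most an eighth of the squared
Frobenius distance of their correlation matrices. -/
lemma one_sub_overlap_le {Q R : Matrix (MajIdx n) (MajIdx n) ℝ} {U V : Op n}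
    (hQ : Q ∈ Matrix.orthogonalGroup (MajIdx n) ℝ) (hU : IsFreeFermionicUnitary Q U)
    (hR : R ∈ Matrix.orthogonalGroup (MajIdx n) ℝ) (hV : IsFreeFermionicUnitary R V) :
    8 * (1 - Complex.normSq ((Vᴴ * U) 0 0)) ≤ ∑ μ, ∑ ν, (cov R μ ν - cov Q μ ν) ^ 2 := by
  have hR1 : R * Rᵀ = 1 := (Matrix.mem_orthogonalGroup_iff _ ℝ).1 hR
  have hRt : Rᵀ ∈ Matrix.orthogonalGroup (MajIdx n) ℝ := Unitary.star_mem hR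
  have h1 := one_sub_normSq_le ((hV.conjTranspose hR).mul hU)
  have h2 := sum_sq_vacuumCov_sub_cov (mul_mem hRt hQ)
  have h3 := sum_sq_conj hR (vacuumCov n - cov (Rᵀ * Q))
  -- Rotating by `R` undoes the reduction to the vacuum without changing the Frobenius norm.
  have h4 : R * (vacuumCov n - cov (Rᵀ * Q)) * Rᵀ = cov R - cov Q := by
    rw [mul_sub, sub_mul, cov, cov, cov]
    congr 1
    calc R * (Rᵀ * Q * vacuumCov n * (Rᵀ * Q)ᵀ) * Rᵀ
        = (R * Rᵀ) * Q * vacuumCov n * Qᵀ * (R * Rᵀ) := by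
          simp only [Matrix.transpose_mul, Matrix.transpose_transpose, mul_assoc]
      _ = _ := by rw [hR1, one_mul, mul_one]
  rw [h4] at h3
  simp only [Matrix.sub_apply] at h3
  rw [h3, h2]
  linarith

/-! ## Trace distance of pure states -/

/-- Every eigenvalue is `0` or `c`, and the trace says that `c` occurs twice when it is nonzero. It
is applied to `B = A†A` for a difference `A` of two rank-one projectors. -/
lemma sum_sqrt_eigenvalues_eq {m : Type*} [Fintype m] [DecidableEq m] {B : Matrix m m ℂ}
    (hB : B.IsHermitian) {c : ℝ} (hc : 0 ≤ c) (hBB : B * B = (c : ℂ) • B)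
    (htr : B.trace = ((2 * c : ℝ) : ℂ)) : ∑ x, √(hB.eigenvalues x) = 2 * √c := by
  have hev : ∀ x, hB.eigenvalues x = 0 ∨ hB.eigenvalues x = c := fun x => by
    have h := hB.mulVec_eigenvectorBasis x
    have h2 : (hB.eigenvalues x * hB.eigenvalues x) • (hB.eigenvectorBasis x).ofLp =
        (c * hB.eigenvalues x) • (hB.eigenvectorBasis x).ofLp := by
      calc (hB.eigenvalues x * hB.eigenvalues x) • (hB.eigenvectorBasis x).ofLp
          = B *ᵥ (B *ᵥ (hB.eigenvectorBasis x).ofLp) := by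
            rw [h, Matrix.mulVec_smul, h, smul_smul]
        _ = _ := by
            rw [Matrix.mulVec_mulVec, hBB, Matrix.smul_mulVec, h, mul_smul, Complex.coe_smul]
    have hne : (hB.eigenvectorBasis x).ofLp ≠ 0 := fun h0 =>
      hB.eigenvectorBasis.orthonormal.ne_zero x (by ext i; exact congrFun h0 i)
    have h3 := smul_left_injective ℝ hne h2
    rcases mul_eq_mul_right_iff.1 h3 with h | h
    · exact Or.inr h
    · exact Or.inl h
  have hsum : ∑ x, hB.eigenvalues x = 2 * c := by
    have : ((∑ x, hB.eigenvalues x : ℝ) : ℂ) = ((2 * c : ℝ) : ℂ) := by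
      rw [← htr, hB.trace_eq_sum_eigenvalues, Complex.ofReal_sum]
      rfl
    exact_mod_cast this
  rcases hc.eq_or_lt with rfl | hc
  · have : ∀ x, hB.eigenvalues x = 0 := fun x => by simpa using hev x
    simp [this]
  · have hs : 0 < √c := Real.sqrt_pos.2 hc
    -- This identity holds for both possible eigenvalues and avoids counting multiplicities.
    have hx : ∀ x, √(hB.eigenvalues x) * √c = hB.eigenvalues x := fun x => by
      rcases hev x with h | h <;> rw [h]
      · simp
      · exact Real.mul_self_sqrt hc.le
    refine mul_right_cancel₀ hs.ne' ?_
    rw [Finset.sum_mul, Finset.sum_congr rfl fun x _ => hx x, hsum, mul_assoc,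
      Real.mul_self_sqrt hc.le]

lemma zeroState_sandwich (M : Op n) :
    zeroState n * M * zeroState n = M 0 0 • zeroState n := by
  rw [zeroState, Matrix.single_mul_mul_single]
  simp

lemma trace_mul_zeroState (M : Op n) : (M * zeroState n).trace = M 0 0 := by
  rw [zeroState, Matrix.trace_mul_single]
  simp

lemma conjTranspose_zeroState : (zeroState n)ᴴ = zeroState n := by
  simp [zeroState]

lemma schattenOneNorm_sub {U V : Op n} (hU : U ∈ Matrix.unitaryGroup (Fin n → Fin 2) ℂ)
    (hV : V ∈ Matrix.unitaryGroup (Fin n → Fin 2) ℂ) :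
    schattenOneNorm (V * zeroState n * Vᴴ - U * zeroState n * Uᴴ) =
      2 * √(1 - Complex.normSq ((Vᴴ * U) 0 0)) := by
  have hU1 : Uᴴ * U = 1 := (Matrix.mem_unitaryGroup_iff').1 hU
  have hV1 : Vᴴ * V = 1 := (Matrix.mem_unitaryGroup_iff').1 hV
  set F := Complex.normSq ((Vᴴ * U) 0 0) with hF
  have hF1 : F ≤ 1 := by
    have hW : Vᴴ * U ∈ Matrix.unitaryGroup (Fin n → Fin 2) ℂ :=
      mul_mem (Unitary.star_mem hV) hU
    rw [hF, ← sum_normSq_col hW 0]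
    exact Finset.single_le_sum (f := fun x => Complex.normSq ((Vᴴ * U) x 0))
      (fun x _ => Complex.normSq_nonneg _) (Finset.mem_univ 0)
  have hstar : (Uᴴ * V) 0 0 = star ((Vᴴ * U) 0 0) := by
    rw [← Matrix.conjTranspose_apply, Matrix.conjTranspose_mul, Matrix.conjTranspose_conjTranspose]
  have hFc : (Vᴴ * U) 0 0 * (Uᴴ * V) 0 0 = (F : ℂ) := by
    rw [hstar, hF, Complex.normSq_eq_conj_mul_self, mul_comm]; rfl
  set P := V * zeroState n * Vᴴ with hP
  set S := U * zeroState n * Uᴴ with hS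
  have hPh : Pᴴ = P := by
    simp [hP, Matrix.conjTranspose_mul, conjTranspose_zeroState, mul_assoc]
  have hSh : Sᴴ = S := by
    simp [hS, Matrix.conjTranspose_mul, conjTranspose_zeroState, mul_assoc]
  have hmul : ∀ A B : Op n, A * zeroState n * Aᴴ * (B * zeroState n * Bᴴ) =
      (Aᴴ * B) 0 0 • (A * zeroState n * Bᴴ) := fun A B => by
    calc A * zeroState n * Aᴴ * (B * zeroState n * Bᴴ)
        = A * (zeroState n * (Aᴴ * B) * zeroState n) * Bᴴ := by simp only [mul_assoc]
      _ = _ := by rw [zeroState_sandwich, Matrix.mul_smul, Matrix.smul_mul]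
  have hPP : P * P = P := by rw [hP, hmul, hV1]; simp
  have hSS : S * S = S := by rw [hS, hmul, hU1]; simp
  have hmul' : ∀ A B : Op n, A * zeroState n * Bᴴ * (A * zeroState n * Aᴴ) =
      (Bᴴ * A) 0 0 • (A * zeroState n * Aᴴ) := fun A B => by
    calc A * zeroState n * Bᴴ * (A * zeroState n * Aᴴ)
        = A * (zeroState n * (Bᴴ * A) * zeroState n) * Aᴴ := by simp only [mul_assoc]
      _ = _ := by rw [zeroState_sandwich, Matrix.mul_smul, Matrix.smul_mul]
  have hPSP : P * S * P = (F : ℂ) • P := by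
    rw [hP, hS, hmul, Matrix.smul_mul, hmul', smul_smul, hFc]
  have hSPS : S * P * S = (F : ℂ) • S := by
    rw [hP, hS, hmul, Matrix.smul_mul, hmul', smul_smul, mul_comm, hFc]
  have htrP : P.trace = 1 := by
    rw [hP, Matrix.trace_mul_comm, ← mul_assoc, hV1, one_mul, zeroState]; simp
  have htrS : S.trace = 1 := by
    rw [hS, Matrix.trace_mul_comm, ← mul_assoc, hU1, one_mul, zeroState]; simp
  have htrPS : (P * S).trace = F := by
    rw [hP, hS, hmul, Matrix.trace_smul, Matrix.trace_mul_comm, ← mul_assoc,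
      trace_mul_zeroState, smul_eq_mul, hFc]
  have hAA : (P - S)ᴴ * (P - S) = P + S - P * S - S * P := by
    rw [Matrix.conjTranspose_sub, hPh, hSh, sub_mul, mul_sub, mul_sub, hPP, hSS]; abel
  -- With `A = P - S` this reads `A³ = (1 - F) A`, so `A†A` satisfies the quadratic relation needed
  -- with `c = 1 - F`.
  have hA3 : (P - S) * (P + S - P * S - S * P) = ((1 - F : ℝ) : ℂ) • (P - S) := by
    have e : (P - S) * (P + S - P * S - S * P) =
        P * P + P * S - P * P * S - P * S * P - S * P - S * S + S * P * S + S * S * P := by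
      noncomm_ring
    rw [e, hPP, hSS, hPSP, hSPS]
    push_cast
    module
  refine sum_sqrt_eigenvalues_eq _ (sub_nonneg.2 hF1) ?_ ?_
  · calc (P - S)ᴴ * (P - S) * ((P - S)ᴴ * (P - S))
        = (P - S)ᴴ * ((P - S) * ((P - S)ᴴ * (P - S))) := by rw [mul_assoc]
      _ = _ := by
        rw [hAA, hA3, Matrix.mul_smul, hAA]
  · rw [hAA, Matrix.trace_sub, Matrix.trace_sub, Matrix.trace_add, Matrix.trace_mul_comm S P,
      htrP, htrS, htrPS]
    push_cast
    ring

lemma schattenOneNorm_sub_le {Q R : Matrix (MajIdx n) (MajIdx n) ℝ} {U V : Op n} {ε : ℝ}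
    (hQ : Q ∈ Matrix.orthogonalGroup (MajIdx n) ℝ) (hU : IsFreeFermionicUnitary Q U)
    (hR : R ∈ Matrix.orthogonalGroup (MajIdx n) ℝ) (hV : IsFreeFermionicUnitary R V)
    (hε : 0 ≤ ε) (h : ∑ μ, ∑ ν, (cov R μ ν - cov Q μ ν) ^ 2 ≤ 2 * ε ^ 2) :
    schattenOneNorm (V * zeroState n * Vᴴ - U * zeroState n * Uᴴ) ≤ ε := by
  rw [schattenOneNorm_sub hU.1 hV.1]
  have h1 := one_sub_overlap_le hQ hU hR hV
  have : √(1 - Complex.normSq ((Vᴴ * U) 0 0)) ≤ ε / 2 := by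
    refine Real.sqrt_le_iff.2 ⟨by linarith, ?_⟩
    nlinarith
  linarith

/-! ## Pure free-fermionic states -/

/-- The product of the Pauli `X` on the qubits where `x` is one. -/
def bitFlip (x : Fin n → Fin 2) : Op n := tensor fun j => if x j = 0 then 1 else pauliX

lemma conjTranspose_bitFlip (x : Fin n → Fin 2) : (bitFlip x)ᴴ = bitFlip x := by
  rw [bitFlip, conjTranspose_tensor]
  congr 1; funext j
  split_ifs <;> simp [conjTranspose_pauliX]

lemma bitFlip_mul_self (x : Fin n → Fin 2) : bitFlip x * bitFlip x = 1 := by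
  rw [bitFlip, tensor_mul, ← tensor_one]
  congr 1; funext j
  split_ifs <;> simp [pauliX_mul_self]

/-- Conjugation by `X` fixes `X` and negates `Y` and `Z`, so each flipped site contributes a sign.
-/
lemma exists_bitFlip_conj_majorana (x : Fin n → Fin 2) (μ : MajIdx n) :
    ∃ s : ℝ, s * s = 1 ∧ bitFlip x * majorana μ * bitFlip x = (s : ℂ) • majorana μ := by
  have hZ : pauliX * pauliZ * pauliX = (-1 : ℂ) • pauliZ := by
    rw [pauliX_mul_pauliZ, neg_mul, mul_assoc, pauliX_mul_self]; simp
  have hY : pauliX * pauliY * pauliX = (-1 : ℂ) • pauliY := by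
    rw [pauliX_mul_pauliY, neg_mul, mul_assoc, pauliX_mul_self]; simp
  have hX : pauliX * pauliX * pauliX = pauliX := by
    rw [pauliX_mul_self, one_mul]
  have h : ∀ j, ∃ s : ℝ, s * s = 1 ∧ (if x j = 0 then 1 else pauliX) *
      (if j < μ.1 then pauliZ else if j = μ.1 then (if μ.2 = 0 then pauliX else pauliY) else 1) *
      (if x j = 0 then 1 else pauliX) = (s : ℂ) •
      (if j < μ.1 then pauliZ else if j = μ.1 then (if μ.2 = 0 then pauliX else pauliY) else 1) := by
    intro j
    by_cases hx : x j = 0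
    · exact ⟨1, by norm_num, by simp [hx]⟩
    · simp only [hx, if_false]
      split_ifs
      · exact ⟨-1, by norm_num, by rw [hZ]; norm_num⟩
      · exact ⟨1, by norm_num, by rw [hX]; norm_num⟩
      · exact ⟨-1, by norm_num, by rw [hY]; norm_num⟩
      · exact ⟨1, by norm_num, by rw [mul_one, pauliX_mul_self]; norm_num⟩
  choose s hs hs' using h
  refine ⟨∏ j, s j, by rw [← Finset.prod_mul_distrib]; simp [hs], ?_⟩
  rw [bitFlip, majorana, tensor_mul, tensor_mul, funext hs', tensor_smul]
  push_cast
  rfl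

lemma exists_isFreeFermionicUnitary_bitFlip (x : Fin n → Fin 2) :
    ∃ D ∈ Matrix.orthogonalGroup (MajIdx n) ℝ, IsFreeFermionicUnitary D (bitFlip x) := by
  choose s hs hs' using exists_bitFlip_conj_majorana x
  refine ⟨Matrix.diagonal s, ?_, ?_, fun μ => ?_⟩
  · rw [Matrix.mem_orthogonalGroup_iff]
    simp [hs]
  · rw [Matrix.mem_unitaryGroup_iff, Matrix.star_eq_conjTranspose, conjTranspose_bitFlip,
      bitFlip_mul_self]
  · rw [conjTranspose_bitFlip, hs', Finset.sum_eq_single μ] <;>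
      simp +contextual [eq_comm]

lemma bitFlip_conj_zeroState (x : Fin n → Fin 2) :
    bitFlip x * zeroState n * (bitFlip x)ᴴ = Matrix.single x x 1 := by
  have hz : ∀ y : Fin n → Fin 2, Matrix.single y y (1 : ℂ) =
      tensor fun j => Matrix.diagonal (Pi.single (y j) 1) := fun y => by
    rw [tensor_diagonal, ← Matrix.diagonal_single]
    congr 1; funext z
    by_cases h : z = y
    · subst h; simp
    · obtain ⟨j, hj⟩ := Function.ne_iff.1 h
      rw [Pi.single_eq_of_ne h]
      exact (Finset.prod_eq_zero (Finset.mem_univ j) (by simp [hj])).symm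
  rw [conjTranspose_bitFlip, zeroState, hz, hz, bitFlip, tensor_mul, tensor_mul]
  have hd : ∀ a : Fin 2, Matrix.diagonal (Pi.single a (1 : ℂ)) =
      if a = 0 then !![1, 0; 0, 0] else !![0, 0; 0, 1] := fun a => by
    ext i k
    fin_cases a <;> fin_cases i <;> fin_cases k <;> simp
  congr 1; funext j
  rw [hd, hd, Pi.zero_apply]
  generalize x j = a
  ext i k
  fin_cases a <;> fin_cases i <;> fin_cases k <;> simp [pauliX]

/-- Rank one leaves a single nonzero diagonal entry, and it equals 1 because the entries sum to `∏
j, 1`. -/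
lemma exists_diagonal_eq_single {n : ℕ} {lam : Fin n → ℝ}
    (h : (Matrix.diagonal fun x : Fin n → Fin 2 =>
      ∏ j, ![(1 + (lam j : ℂ)) / 2, (1 - (lam j : ℂ)) / 2] (x j)).rank = 1) :
    ∃ x, (Matrix.diagonal fun x : Fin n → Fin 2 =>
      ∏ j, ![(1 + (lam j : ℂ)) / 2, (1 - (lam j : ℂ)) / 2] (x j)) = Matrix.single x x 1 := by
  classical
  set p : Fin n → Fin 2 → ℂ := fun j => ![(1 + (lam j : ℂ)) / 2, (1 - (lam j : ℂ)) / 2] with hp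
  rw [Matrix.rank_diagonal, Fintype.card_eq_one_iff] at h
  obtain ⟨⟨x, hx⟩, hu⟩ := h
  have hsum : ∑ y : Fin n → Fin 2, ∏ j, p j (y j) = 1 := by
    rw [← Fintype.prod_sum]
    refine Finset.prod_eq_one fun j _ => ?_
    simp only [hp, Fin.sum_univ_two, Matrix.cons_val_zero, Matrix.cons_val_one]
    ring
  have hz : ∀ y, y ≠ x → ∏ j, p j (y j) = 0 := fun y hy => by
    by_contra hne
    exact hy (congrArg Subtype.val (hu ⟨y, hne⟩))
  refine ⟨x, ?_⟩
  rw [← Matrix.diagonal_single]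
  congr 1; funext y
  by_cases hy : y = x
  · subst hy
    rw [Finset.sum_eq_single y (fun z _ h => hz z h) (by simp)] at hsum
    rw [Pi.single_eq_same, hsum]
  · rw [Pi.single_eq_of_ne hy, hz y hy]

/-- Every pure free-fermionic state is of the form `U_Q |0ⁿ⟩⟨0ⁿ| U_Q†`. -/
lemma IsPureFreeFermionicState.exists_eq {ψ : Op n} (h : IsPureFreeFermionicState ψ) :
    ∃ Q ∈ Matrix.orthogonalGroup (MajIdx n) ℝ, ∃ U, IsFreeFermionicUnitary Q U ∧
      ψ = U * zeroState n * Uᴴ := by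
  obtain ⟨⟨Q, hQ, U, hU, lam, -, rfl⟩, hr⟩ := h
  have ht : tensor (fun j => (1 / 2 : ℂ) • (1 + (lam j : ℂ) • pauliZ)) =
      Matrix.diagonal fun x : Fin n → Fin 2 =>
        ∏ j, ![(1 + (lam j : ℂ)) / 2, (1 - (lam j : ℂ)) / 2] (x j) := by
    rw [← tensor_diagonal]
    congr 1; funext j
    ext a b
    fin_cases a <;> fin_cases b <;> simp [pauliZ] <;> ring
  have hU1 : Uᴴ * U = 1 := (Matrix.mem_unitaryGroup_iff').1 hU.1
  have hUdet : IsUnit U.det := Matrix.isUnit_det_of_left_inverse hU1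
  have hUdet' : IsUnit Uᴴ.det := Matrix.isUnit_det_of_right_inverse hU1
  rw [Matrix.rank_mul_eq_left_of_isUnit_det _ _ hUdet',
    Matrix.rank_mul_eq_right_of_isUnit_det _ _ hUdet, ht] at hr
  obtain ⟨x, hx⟩ := exists_diagonal_eq_single hr
  obtain ⟨D, hD, hDU⟩ := exists_isFreeFermionicUnitary_bitFlip x
  refine ⟨Q * D, mul_mem hQ hD, U * bitFlip x, hU.mul hDU, ?_⟩
  rw [ht, hx, ← bitFlip_conj_zeroState, Matrix.conjTranspose_mul]
  simp only [mul_assoc]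

/-! ## Joint measurement of commuting bilinears -/

/-- The eigenvalue `±1` encoded by a binary outcome. -/
def boolSign (b : Bool) : ℝ := if b then 1 else -1

lemma abs_boolSign (b : Bool) : |boolSign b| = 1 := by
  cases b <;> simp [boolSign]

/-- The spectral projector of a Hermitian involution. -/
def signProj (B : Op n) (b : Bool) : Op n := (1 / 2 : ℝ) • (1 + boolSign b • B)

lemma signProj_idem {B : Op n} (hB : B * B = 1) (b : Bool) :
    signProj B b * signProj B b = signProj B b := by
  have h : (1 + boolSign b • B) * (1 + boolSign b • B) = (2 : ℝ) • (1 + boolSign b • B) := by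
    have hb : boolSign b * boolSign b = 1 := by cases b <;> simp [boolSign]
    rw [add_mul, mul_add, mul_add, smul_mul_smul_comm, hB, hb, one_mul, mul_one, one_mul]
    module
  rw [signProj, smul_mul_smul_comm, h, smul_smul]
  norm_num

lemma isHermitian_signProj {B : Op n} (hB : B.IsHermitian) (b : Bool) :
    (signProj B b).IsHermitian := by
  rw [Matrix.IsHermitian, signProj, Matrix.conjTranspose_smul, Matrix.conjTranspose_add,
    Matrix.conjTranspose_smul, Matrix.conjTranspose_one, hB.eq]
  simp

/-- The projections are products of the spectral projectors of the `B i`. The final clause, on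
operators commuting with all `B i`, is what lets the induction multiply by a projector of a further
involution. -/
lemma exists_joint_projections {m : ℕ} (B : Fin m → Op n) (hH : ∀ i, (B i).IsHermitian)
    (hsq : ∀ i, B i * B i = 1) (hcomm : ∀ i j, Commute (B i) (B j)) :
    ∃ E : (Fin m → Bool) → Op n, (∀ a, (E a).IsHermitian ∧ E a * E a = E a) ∧
      ∑ a, E a = 1 ∧ (∀ i, ∑ a, boolSign (a i) • E a = B i) ∧
      ∀ X, (∀ i, Commute X (B i)) → ∀ a, Commute X (E a) := by
  induction m with
  | zero => exact ⟨fun _ => 1, fun _ => ⟨Matrix.isHermitian_one, mul_one 1⟩, by simp,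
      fun i => i.elim0, fun X _ _ => Commute.one_right X⟩
  | succ m ih =>
    obtain ⟨E, hE, hE1, hEB, hEc⟩ := ih (fun i => B i.succ) (fun i => hH _) (fun i => hsq _)
      (fun i j => hcomm _ _)
    have hPc : ∀ X, Commute X (B 0) → ∀ b, Commute X (signProj (B 0) b) := fun X hX b =>
      ((Commute.one_right X).add_right (hX.smul_right _)).smul_right _
    have hPE : ∀ b a, Commute (signProj (B 0) b) (E a) := fun b a =>
      (hPc _ (hEc _ (fun i => hcomm _ _) a).symm b).symm
    have hsum : ∀ (g : Bool → (Fin m → Bool) → Op n),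
        ∑ a : Fin (m + 1) → Bool, g (a 0) (Fin.tail a) = ∑ b, ∑ a, g b a := fun g => by
      rw [← (Fin.consEquiv fun _ => Bool).sum_comp, Fintype.sum_prod_type]
      simp [Fin.consEquiv]
    have hP1 : ∑ b, signProj (B 0) b = 1 := by
      simp only [Fintype.sum_bool, signProj, boolSign, if_true]
      simp only [Bool.false_eq_true, if_false]
      module
    have hPB : ∑ b, boolSign b • signProj (B 0) b = B 0 := by
      simp only [Fintype.sum_bool, signProj, boolSign, if_true]
      simp only [Bool.false_eq_true, if_false]
      module
    refine ⟨fun a => signProj (B 0) (a 0) * E (Fin.tail a), fun a => ⟨?_, ?_⟩, ?_, ?_, ?_⟩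
    · rw [Matrix.IsHermitian, Matrix.conjTranspose_mul, (hE _).1.eq,
        (isHermitian_signProj (hH 0) _).eq]
      exact (hPE _ _).symm.eq
    · rw [(hPE _ _).symm.mul_mul_mul_comm, signProj_idem (hsq 0), (hE _).2]
    · rw [hsum fun b a => signProj (B 0) b * E a, ← Finset.sum_mul_sum, hP1, hE1, one_mul]
    · intro i
      refine Fin.cases ?_ (fun i => ?_) i
      · rw [hsum fun b a => boolSign b • (signProj (B 0) b * E a)]
        simp only [← Matrix.smul_mul]
        rw [← Finset.sum_mul_sum, hPB, hE1, mul_one]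
      · have := hsum fun b a => boolSign (a i) • (signProj (B 0) b * E a)
        simp only [Fin.tail] at this ⊢
        rw [this]
        simp only [← Matrix.mul_smul]
        rw [← Finset.sum_mul_sum, hP1, hEB, one_mul]
    · exact fun X hX a => (hPc X (hX 0) _).mul_right (hEc X (fun i => hX _) _)

/-- The value in `{-1, 0, 1}` that an outcome assigns to the bilinear `-i γ_μ γ_ν`. It is
antisymmetric in `μ` and `ν`. -/
def pairSign (μ ν : MajIdx n) (a : Fin (n * 2) → Bool) : ℝ :=
  (boolSign (a (finProdFinEquiv μ)) - boolSign (a (finProdFinEquiv ν))) / 2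

lemma abs_pairSign_le (μ ν : MajIdx n) (a : Fin (n * 2) → Bool) : |pairSign μ ν a| ≤ 1 := by
  rw [pairSign, abs_div, abs_two, div_le_one two_pos]
  refine (abs_sub _ _).trans ?_
  rw [abs_boolSign, abs_boolSign]
  norm_num

lemma pairSign_swap (μ ν : MajIdx n) (a : Fin (n * 2) → Bool) :
    pairSign ν μ a = -pairSign μ ν a := by
  simp only [pairSign]; ring

/-- All bilinears `-i γ_μ γ_ν` with a given sum `μ + ν` can be measured jointly. -/
lemma exists_povm_bilinear [NeZero n] (c : MajIdx n) :
    ∃ M : Povm n (Fin (n * 2) → Bool), ∀ μ ν, μ ≠ ν → μ + ν = c → ∀ ρ : Op n,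
      ∑ a, pairSign μ ν a * M.born ρ a = (bilinear μ ν * ρ).trace.re := by
  -- At a fixed point of `μ ↦ c - μ` the bilinear would be `-i`, which is not Hermitian, so the
  -- identity serves as a filler.
  let B : MajIdx n → Op n := fun μ => if μ = c - μ then 1 else bilinear μ (c - μ)
  have hc : ∀ {μ ν : MajIdx n}, μ + ν = c → c - μ = ν := fun h => by rw [← h]; abel
  obtain ⟨E, hE, hE1, hEB, -⟩ := exists_joint_projections (fun i => B (finProdFinEquiv.symm i))
    (fun i => by
      dsimp only [B]
      split_ifs with h
      exacts [Matrix.isHermitian_one, isHermitian_bilinear h])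
    (fun i => by
      dsimp only [B]
      split_ifs with h
      exacts [mul_one 1, bilinear_mul_self h])
    (fun i j => by
      dsimp only [B]
      generalize finProdFinEquiv.symm i = μ
      generalize finProdFinEquiv.symm j = ν
      split_ifs with h₁ h₂
      · exact Commute.one_left _
      · exact Commute.one_left _
      · exact Commute.one_right _
      · refine commute_bilinear h₁ ?_
        by_cases e₁ : μ = ν
        · exact Or.inl ⟨e₁, by rw [e₁]⟩
        by_cases e₂ : μ = c - ν
        · exact Or.inr (Or.inl ⟨e₂, by rw [e₂]; abel⟩)
        · refine Or.inr (Or.inr ⟨e₁, e₂, fun e => e₂ ?_, fun e => e₁ ?_⟩)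
          · rw [← e]; abel
          · exact sub_right_injective e)
  refine ⟨⟨E, fun a => ?_, hE1⟩, fun μ ν hμν hs ρ => ?_⟩
  · have := Matrix.posSemidef_conjTranspose_mul_self (E a)
    rwa [(hE a).1.eq, (hE a).2] at this
  · have hsum : ∑ a, pairSign μ ν a • E a = bilinear μ ν := by
      have h1 := hEB (finProdFinEquiv μ)
      have h2 := hEB (finProdFinEquiv ν)
      simp only [Equiv.symm_apply_apply, B] at h1 h2
      rw [hc hs, if_neg hμν] at h1
      rw [hc ((add_comm ν μ).trans hs), if_neg hμν.symm, bilinear_swap hμν] at h2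
      have : ∀ a, pairSign μ ν a • E a = (1 / 2 : ℝ) • (boolSign (a (finProdFinEquiv μ)) • E a)
          - (1 / 2 : ℝ) • (boolSign (a (finProdFinEquiv ν)) • E a) := fun a => by
        rw [pairSign]; module
      simp only [this, Finset.sum_sub_distrib, ← Finset.smul_sum, h1, h2]
      module
    rw [← hsum, Finset.sum_mul, Matrix.trace_sum, Complex.re_sum]
    refine Finset.sum_congr rfl fun a _ => ?_
    rw [Matrix.smul_mul, Matrix.trace_smul, Complex.smul_re, smul_eq_mul, Povm.born]

lemma trace_mul_pure (M U : Op n) :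
    (M * (U * zeroState n * Uᴴ)).trace = (Uᴴ * M * U) 0 0 := by
  rw [← trace_mul_zeroState (Uᴴ * M * U), ← mul_assoc, Matrix.trace_mul_comm]
  simp only [mul_assoc]

lemma Povm.born_pure_nonneg {Ω : Type} [Fintype Ω] (M : Povm n Ω) (U : Op n) (a : Ω) :
    0 ≤ M.born (U * zeroState n * Uᴴ) a := by
  rw [Povm.born, trace_mul_pure]
  have := ((M.posSemidef a).conjTranspose_mul_mul_same U).diag_nonneg (i := 0)
  exact (Complex.le_def.1 this).1

lemma Povm.sum_born_pure {Ω : Type} [Fintype Ω] (M : Povm n Ω) {U : Op n}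
    (hU : U ∈ Matrix.unitaryGroup (Fin n → Fin 2) ℂ) :
    ∑ a, M.born (U * zeroState n * Uᴴ) a = 1 := by
  simp only [Povm.born]
  rw [← Complex.re_sum, ← Matrix.trace_sum, ← Finset.sum_mul, M.sum_eq_one, trace_mul_pure,
    mul_one, show Uᴴ * U = 1 from (Matrix.mem_unitaryGroup_iff').1 hU]
  simp

/-! ## Concentration -/

open MeasureTheory ProbabilityTheory in
/-- Hoeffding's lemma for a finite distribution. -/
lemma sum_mul_exp_le {Ω : Type*} [Fintype Ω] {p f : Ω → ℝ} (hp : ∀ a, 0 ≤ p a)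
    (hp1 : ∑ a, p a = 1) (hf : ∀ a, |f a| ≤ 1) {m : ℝ} (hm : ∑ a, f a * p a = m) (t : ℝ) :
    ∑ a, p a * Real.exp (t * (f a - m)) ≤ Real.exp (t ^ 2 / 2) := by
  let _ : MeasurableSpace Ω := ⊤
  let P : Measure Ω := ∑ a, ENNReal.ofReal (p a) • Measure.dirac a
  have hint : ∀ g : Ω → ℝ, ∫ x, g x ∂P = ∑ a, p a * g a := fun g => by
    rw [integral_finsetSum_measure fun a _ =>
      (integrable_dirac (by simp)).smul_measure ENNReal.ofReal_ne_top]
    refine Finset.sum_congr rfl fun a _ => ?_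
    rw [integral_smul_measure, integral_dirac, ENNReal.toReal_ofReal (hp a), smul_eq_mul]
  have : IsProbabilityMeasure P := ⟨by
    simp only [P, Measure.coe_finsetSum, Finset.sum_apply, Measure.smul_apply, measure_univ,
      smul_eq_mul, mul_one]
    rw [← ENNReal.ofReal_sum_of_nonneg fun a _ => hp a, hp1, ENNReal.ofReal_one]⟩
  -- The interval `[-1, 1]` has half-width 1, so the variance proxy is 1.
  have h := (hasSubgaussianMGF_of_mem_Icc (μ := P) (X := f) (a := -1) (b := 1)
    (measurable_from_top.aemeasurable)
    (Filter.Eventually.of_forall fun a => abs_le.1 (hf a))).mgf_le t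
  rw [mgf, hint, hint] at h
  have hm' : ∑ a, p a * f a = m := by rw [← hm]; exact Finset.sum_congr rfl fun a _ => mul_comm _ _
  rw [hm'] at h
  refine h.trans_eq ?_
  congr 1
  norm_num

/-- One-sided Hoeffding bound for a product of finite distributions. -/
lemma sum_prod_le_exp {N : ℕ} {Ω : Type*} [Fintype Ω] {p : Fin N → Ω → ℝ}
    (hp : ∀ i a, 0 ≤ p i a) (hp1 : ∀ i, ∑ a, p i a = 1) {f : Ω → ℝ} (hf : ∀ a, |f a| ≤ 1)
    {m : ℝ} (I : Finset (Fin N)) (hm : ∀ i ∈ I, ∑ a, f a * p i a = m) {η : ℝ} (hη : 0 ≤ η)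
    (bad : (Fin N → Ω) → Prop) [DecidablePred bad]
    (hbad : ∀ w, bad w → I.card * (m + η) ≤ ∑ i ∈ I, f (w i)) :
    ∑ w with bad w, ∏ i, p i (w i) ≤ Real.exp (-(I.card * η ^ 2 / 2)) := by
  classical
  -- Chernoff weight with the optimal tilt `t = η`, which minimises `t² / 2 - t η`; copies outside
  -- `I` are left untilted.
  let g : Fin N → Ω → ℝ := fun i a => if i ∈ I then Real.exp (η * (f a - m)) else 1
  have hg : ∀ i a, 0 ≤ g i a := fun i a => by
    dsimp only [g]; split_ifs <;> positivity
  have hprod : ∀ w : Fin N → Ω, ∏ i, g i (w i) =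
      Real.exp (η * (∑ i ∈ I, f (w i) - I.card * m)) := fun w => by
    simp only [g]
    rw [Finset.prod_ite_mem, Finset.univ_inter, ← Real.exp_sum, ← Finset.mul_sum,
      Finset.sum_sub_distrib, Finset.sum_const, nsmul_eq_mul]
  have hfactor : ∀ i, ∑ a, p i a * g i a ≤ if i ∈ I then Real.exp (η ^ 2 / 2) else 1 :=
    fun i => by
      by_cases hi : i ∈ I
      · simp only [g, if_pos hi]
        exact sum_mul_exp_le (hp i) (hp1 i) hf (hm i hi) η
      · simp only [g, if_neg hi, mul_one, hp1, le_refl]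
  have hnn : ∀ w : Fin N → Ω,
      0 ≤ (∏ i, p i (w i) * g i (w i)) * Real.exp (-(I.card * η ^ 2)) := fun w =>
    mul_nonneg (Finset.prod_nonneg fun i _ => mul_nonneg (hp _ _) (hg _ _)) (Real.exp_pos _).le
  calc ∑ w with bad w, ∏ i, p i (w i)
      ≤ ∑ w with bad w, (∏ i, p i (w i) * g i (w i)) * Real.exp (-(I.card * η ^ 2)) := by
        refine Finset.sum_le_sum fun w hw => ?_
        have hw' := hbad w (Finset.mem_filter.1 hw).2
        rw [Finset.prod_mul_distrib, hprod, mul_assoc, ← Real.exp_add]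
        refine le_mul_of_one_le_right (Finset.prod_nonneg fun i _ => hp _ _)
          (Real.one_le_exp ?_)
        nlinarith
    _ ≤ ∑ w : Fin N → Ω, (∏ i, p i (w i) * g i (w i)) * Real.exp (-(I.card * η ^ 2)) :=
        Finset.sum_le_sum_of_subset_of_nonneg (Finset.filter_subset _ _) fun w _ _ => hnn w
    _ = (∏ i, ∑ a, p i a * g i a) * Real.exp (-(I.card * η ^ 2)) := by
        rw [Fintype.prod_sum, Finset.sum_mul]
    _ ≤ (∏ i, if i ∈ I then Real.exp (η ^ 2 / 2) else 1) * Real.exp (-(I.card * η ^ 2)) := by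
        refine mul_le_mul_of_nonneg_right (Finset.prod_le_prod (fun i _ =>
          Finset.sum_nonneg fun a _ => mul_nonneg (hp _ _) (hg _ _)) fun i _ => hfactor i)
          (Real.exp_pos _).le
    _ = _ := by
        rw [Finset.prod_ite_mem, Finset.univ_inter, Finset.prod_const, ← Real.exp_nat_mul,
          ← Real.exp_add]
        congr 1
        ring

/-- A union bound for finite distributions. -/
lemma one_sub_card_mul_le_sum {W β : Type*} [Fintype W] [Fintype β] {q : W → ℝ}
    (hq : ∀ w, 0 ≤ q w) (hq1 : ∑ w, q w = 1) (bad : β → W → Prop)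
    [∀ b, DecidablePred (bad b)] {τ : ℝ} (hbad : ∀ b, ∑ w with bad b w, q w ≤ τ)
    (S : W → Prop) [DecidablePred S] (hS : ∀ w, (∀ b, ¬ bad b w) → S w) :
    1 - Fintype.card β * τ ≤ ∑ w with S w, q w := by
  classical
  have h1 := Finset.sum_filter_add_sum_filter_not Finset.univ S q
  have h2 : ∑ w with ¬ S w, q w ≤ ∑ b, ∑ w with bad b w, q w := by
    simp only [Finset.sum_filter]
    rw [Finset.sum_comm]
    refine Finset.sum_le_sum fun w _ => ?_
    have hnn : ∀ b, 0 ≤ if bad b w then q w else 0 := fun b => by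
      split_ifs
      exacts [hq w, le_rfl]
    by_cases hw : S w
    · simpa [hw] using Finset.sum_nonneg fun b _ => hnn b
    · obtain ⟨b, hb⟩ := not_forall_not.1 fun h => hw (hS w h)
      have := Finset.single_le_sum (fun b _ => hnn b) (Finset.mem_univ b)
      simpa [hw, hb] using this
  have h3 : ∑ b, ∑ w with bad b w, q w ≤ Fintype.card β * τ := by
    have := Finset.sum_le_card_nsmul Finset.univ _ τ fun b _ => hbad b
    rwa [nsmul_eq_mul, Finset.card_univ] at this
  linarith

/-! ## The learner -/

/-- The class of bilinears measured on the `i`-th copy; classes are cycled through. -/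
def copyClass (N : ℕ) [NeZero n] (i : Fin N) : MajIdx n :=
  finProdFinEquiv.symm (Fin.ofNat (n * 2) i)

/-- The copies numbered `j * (n * 2) + r`, with `r` the code of `c`, all lie in class `c`, one for
each complete cycle `j`. -/
lemma div_le_card_copyClass (N : ℕ) [NeZero n] (c : MajIdx n) :
    N / (n * 2) ≤ (Finset.univ.filter fun i : Fin N => copyClass N i = c).card := by
  have hpos : 0 < n * 2 := Nat.mul_pos (NeZero.pos n) two_pos
  set r := finProdFinEquiv c with hr
  have hlt : ∀ j < N / (n * 2), j * (n * 2) + r < N := fun j hj => by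
    have h1 := Nat.div_mul_le_self N (n * 2)
    have h2 : (j + 1) * (n * 2) ≤ N / (n * 2) * (n * 2) := Nat.mul_le_mul_right _ hj
    have h3 := r.2
    rw [add_mul] at h2
    omega
  have := Finset.card_le_card_of_injOn (s := Finset.univ)
    (t := Finset.univ.filter fun i : Fin N => copyClass N i = c)
    (fun j : Fin (N / (n * 2)) => (⟨j * (n * 2) + r, hlt j j.2⟩ : Fin N)) (fun j _ => ?_)
    (fun j _ k _ h => ?_)
  · simpa using this
  · refine Finset.mem_coe.2 (Finset.mem_filter.2 ⟨Finset.mem_univ _, ?_⟩)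
    rw [copyClass, Equiv.symm_apply_eq]
    ext
    simp [Fin.ofNat, Nat.mul_add_mod_of_lt r.2, ← hr]
  · have h' := congrArg Fin.val h
    dsimp only at h'
    exact Fin.ext (Nat.eq_of_mul_eq_mul_right hpos (by omega))

/-- The empirical correlation matrix. -/
def empiricalCov {N : ℕ} [NeZero n] (w : Fin N → Fin (n * 2) → Bool) :
    Matrix (MajIdx n) (MajIdx n) ℝ :=
  Matrix.of fun μ ν => (∑ i with copyClass N i = μ + ν, pairSign μ ν (w i)) /
    (Finset.univ.filter fun i : Fin N => copyClass N i = μ + ν).card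

lemma empiricalCov_swap {N : ℕ} [NeZero n] (w : Fin N → Fin (n * 2) → Bool) (μ ν : MajIdx n) :
    empiricalCov w ν μ = -empiricalCov w μ ν := by
  simp only [empiricalCov, Matrix.of_apply, add_comm ν μ, pairSign_swap μ ν,
    Finset.sum_neg_distrib, neg_div]

/-- Entrywise one-sided bounds on the error of an antisymmetric matrix bound its Frobenius norm. -/
lemma sum_sq_sub_le_of_antisymm {m : Type*} [Fintype m] [DecidableEq m] {A B : m → m → ℝ} {η : ℝ}
    (hA : ∀ μ ν, A ν μ = -A μ ν) (hB : ∀ μ ν, B ν μ = -B μ ν)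
    (h : ∀ μ ν, μ ≠ ν → A μ ν ≤ B μ ν + η) :
    ∑ μ, ∑ ν, (A μ ν - B μ ν) ^ 2 ≤ Fintype.card m * (Fintype.card m - 1) * η ^ 2 := by
  have hle : ∀ μ ν, (A μ ν - B μ ν) ^ 2 ≤ η ^ 2 - if μ = ν then η ^ 2 else 0 := fun μ ν => by
    split_ifs with e
    · subst e
      have h1 : A μ μ = 0 := by linarith [hA μ μ]
      have h2 : B μ μ = 0 := by linarith [hB μ μ]
      simp [h1, h2]
    · rw [sub_zero]
      refine sq_le_sq' ?_ (by linarith [h μ ν e])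
      -- The one-sided bound at the swapped pair is the missing lower bound at `(μ, ν)`.
      have := h ν μ (Ne.symm e)
      rw [hA μ ν, hB μ ν] at this
      linarith
  refine (Finset.sum_le_sum fun μ _ => Finset.sum_le_sum fun ν _ => hle μ ν).trans_eq ?_
  simp [Finset.sum_sub_distrib]
  ring

open Classical in
/-- A realizable orthogonal matrix whose correlation matrix is close to a given one, if any. -/
def roundCov (r : ℝ) (G : Matrix (MajIdx n) (MajIdx n) ℝ) :
    Matrix.orthogonalGroup (MajIdx n) ℝ :=
  if h : ∃ Q : Matrix.orthogonalGroup (MajIdx n) ℝ,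
      (∃ U : Op n, IsFreeFermionicUnitary (Q : Matrix (MajIdx n) (MajIdx n) ℝ) U) ∧
      ∑ μ, ∑ ν, (G μ ν - cov (Q : Matrix (MajIdx n) (MajIdx n) ℝ) μ ν) ^ 2 ≤ r
  then h.choose else 1

lemma roundCov_spec {r : ℝ} {G : Matrix (MajIdx n) (MajIdx n) ℝ}
    {Q : Matrix (MajIdx n) (MajIdx n) ℝ} {U : Op n}
    (hQ : Q ∈ Matrix.orthogonalGroup (MajIdx n) ℝ) (hU : IsFreeFermionicUnitary Q U)
    (h : ∑ μ, ∑ ν, (G μ ν - cov Q μ ν) ^ 2 ≤ r) :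
    (∃ V : Op n, IsFreeFermionicUnitary (roundCov r G : Matrix (MajIdx n) (MajIdx n) ℝ) V) ∧
      ∑ μ, ∑ ν, (G μ ν - cov (roundCov r G : Matrix (MajIdx n) (MajIdx n) ℝ) μ ν) ^ 2 ≤ r := by
  have hex : ∃ Q : Matrix.orthogonalGroup (MajIdx n) ℝ,
      (∃ U : Op n, IsFreeFermionicUnitary (Q : Matrix (MajIdx n) (MajIdx n) ℝ) U) ∧
      ∑ μ, ∑ ν, (G μ ν - cov (Q : Matrix (MajIdx n) (MajIdx n) ℝ) μ ν) ^ 2 ≤ r :=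
    ⟨⟨Q, hQ⟩, ⟨U, hU⟩, h⟩
  rw [roundCov, dif_pos hex]
  exact hex.choose_spec

/-- The learner that measures the bilinears class by class and rounds the empirical correlation
matrix to that of a pure free-fermionic state within squared distance `r`. -/
def covLearner (n N : ℕ) [NeZero n] (r : ℝ) : SingleCopyLearner n N where
  Outcome := Fin (n * 2) → Bool
  meas i := (exists_povm_bilinear (copyClass N i)).choose
  output w := roundCov r (empiricalCov w)

lemma covLearner_prob (N : ℕ) [NeZero n] {r η τ : ℝ} (hη : 0 ≤ η)
    (hr : (n * 2 : ℝ) * (n * 2 - 1) * η ^ 2 ≤ r) (hN : 0 < N / (n * 2))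
    (hτ : 4 * (n : ℝ) ^ 2 * Real.exp (-((N / (n * 2) : ℕ) * η ^ 2 / 2)) ≤ τ)
    {Q : Matrix (MajIdx n) (MajIdx n) ℝ} {U : Op n}
    (hU : IsFreeFermionicUnitary Q U) (S : Set (Fin N → Fin (n * 2) → Bool))
    (hS : ∀ w, ∑ μ, ∑ ν, (empiricalCov w μ ν - cov Q μ ν) ^ 2 ≤ r → w ∈ S) :
    1 - τ ≤ (covLearner n N r).prob (U * zeroState n * Uᴴ) S := by
  classical
  let p : Fin N → (Fin (n * 2) → Bool) → ℝ := fun i =>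
    ((covLearner n N r).meas i).born (U * zeroState n * Uᴴ)
  have hp : ∀ i a, 0 ≤ p i a := fun i a => Povm.born_pure_nonneg _ U a
  have hp1 : ∀ i, ∑ a, p i a = 1 := fun i => Povm.sum_born_pure _ hU.1
  let I : MajIdx n → Finset (Fin N) := fun c => Finset.univ.filter fun i => copyClass N i = c
  have hmean : ∀ μ ν, μ ≠ ν → ∀ i ∈ I (μ + ν), ∑ a, pairSign μ ν a * p i a = cov Q μ ν := by
    intro μ ν h i hi
    have := (exists_povm_bilinear (copyClass N i)).choose_spec μ ν h
      (Finset.mem_filter.1 hi).2.symm (U * zeroState n * Uᴴ)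
    rw [trace_mul_pure, hU.re_conj_bilinear] at this
    exact this
  -- Only overestimates count as failures, since ordered pairs are used and antisymmetry covers
  -- underestimates. Diagonal pairs never fail but are kept in the count `4n²`.
  let bad : MajIdx n × MajIdx n → (Fin N → Fin (n * 2) → Bool) → Prop := fun b w =>
    b.1 ≠ b.2 ∧ (I (b.1 + b.2)).card * (cov Q b.1 b.2 + η) ≤
      ∑ i ∈ I (b.1 + b.2), pairSign b.1 b.2 (w i)
  have hcard : ∀ c, ((N / (n * 2) : ℕ) : ℝ) ≤ (I c).card := fun c => by
    exact_mod_cast div_le_card_copyClass N c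
  have hbad : ∀ b, ∑ w with bad b w, ∏ i, p i (w i) ≤
      Real.exp (-((N / (n * 2) : ℕ) * η ^ 2 / 2)) := fun b => by
    by_cases hb : b.1 = b.2
    · have : ∀ w, ¬ bad b w := fun w h => h.1 hb
      simp only [this, Finset.filter_false, Finset.sum_empty]
      positivity
    · refine (sum_prod_le_exp hp hp1 (abs_pairSign_le b.1 b.2) (I (b.1 + b.2))
        (hmean _ _ hb) hη (bad b) fun w h => h.2).trans (Real.exp_le_exp.2 ?_)
      have := mul_le_mul_of_nonneg_right (hcard (b.1 + b.2)) (sq_nonneg η)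
      linarith
  have hq1 : ∑ w : Fin N → Fin (n * 2) → Bool, ∏ i, p i (w i) = 1 := by
    rw [← Fintype.prod_sum]
    exact Finset.prod_eq_one fun i _ => hp1 i
  have key := one_sub_card_mul_le_sum (fun w => Finset.prod_nonneg fun i _ => hp i (w i)) hq1 bad
    hbad (· ∈ S) fun w hw => hS w ((sum_sq_sub_le_of_antisymm (η := η)
      (fun μ ν => empiricalCov_swap w μ ν) (fun μ ν => cov_swap Q μ ν) fun μ ν h => ?_).trans ?_)
  · have hc : (Fintype.card (MajIdx n × MajIdx n) : ℝ) = 4 * (n : ℝ) ^ 2 := by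
      simp; ring
    rw [hc] at key
    have : (covLearner n N r).prob (U * zeroState n * Uᴴ) S =
        ∑ w : Fin N → Fin (n * 2) → Bool with w ∈ S, ∏ i, p i (w i) := rfl
    rw [this]
    linarith
  · have hlt : ∑ i ∈ I (μ + ν), pairSign μ ν (w i) < (I (μ + ν)).card * (cov Q μ ν + η) :=
      not_le.1 fun h' => hw (μ, ν) ⟨h, h'⟩
    have hpos : (0 : ℝ) < (I (μ + ν)).card :=
      lt_of_lt_of_le (by exact_mod_cast hN) (hcard (μ + ν))
    exact (div_le_iff₀ hpos).2 (by rw [mul_comm]; exact hlt.le)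
  · refine le_trans (le_of_eq ?_) hr
    simp

/-- The number of copies per class suffices for the union bound. -/
lemma copies_per_class {n : ℕ} (hn : 1 ≤ n) {ε L : ℝ} (hε : ε ∈ Set.Ioo (0 : ℝ) 1) (hL : 1 ≤ L) :
    8 * n * (2 * n - 1) * L / ε ^ 2 ≤
      ((⌈32 * ((n : ℝ) ^ 3 / ε ^ 2) * L⌉₊ / (n * 2) : ℕ) : ℝ) := by
  set N := ⌈32 * ((n : ℝ) ^ 3 / ε ^ 2) * L⌉₊
  have hN : 32 * ((n : ℝ) ^ 3 / ε ^ 2) * L ≤ N := Nat.le_ceil _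
  have hn' : (1 : ℝ) ≤ n := by exact_mod_cast hn
  have hdiv : (N : ℝ) < ((N / (n * 2) : ℕ) + 1) * (n * 2) := by
    have := Nat.lt_mul_div_succ N (show 0 < n * 2 by omega)
    rw [mul_comm] at this
    exact_mod_cast this
  -- The floor costs less than one copy per class, which the slack `8 n L / ε²` between `16 n² L /
  -- ε²` and the claimed bound absorbs.
  have hLε : 1 ≤ L / ε ^ 2 := by
    rw [le_div_iff₀ (pow_pos hε.1 2)]
    nlinarith [hε.1, hε.2]
  have e1 : 32 * ((n : ℝ) ^ 3 / ε ^ 2) * L = 16 * n ^ 2 * (L / ε ^ 2) * (n * 2) := by ring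
  have e2 : 8 * n * (2 * n - 1) * L / ε ^ 2 = 16 * n ^ 2 * (L / ε ^ 2) - 8 * n * (L / ε ^ 2) := by
    ring
  have h3 : 16 * n ^ 2 * (L / ε ^ 2) < ((N / (n * 2) : ℕ) : ℝ) + 1 := by
    refine lt_of_mul_lt_mul_right (a := (n * 2 : ℝ)) ?_ (by positivity)
    rw [← e1]
    exact hN.trans_lt hdiv
  rw [e2]
  nlinarith

end FreeFermion

end

theorem proposition6 (n : ℕ) (hn : 1 ≤ n) (ε δ : ℝ)
    (hε : ε ∈ Set.Ioo (0 : ℝ) 1) (hδ : δ ∈ Set.Ioo (0 : ℝ) 1) :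
    ∃ A : FreeFermion.SingleCopyLearner n
        ⌈32 * ((n : ℝ) ^ 3 / ε ^ 2) * Real.log (4 * (n : ℝ) ^ 2 / δ)⌉₊,
      ∀ ψ : FreeFermion.Op n, FreeFermion.IsPureFreeFermionicState ψ →
        1 - δ ≤ A.prob ψ {w |
          (∃ σ, FreeFermion.Represents (A.output w) σ) ∧
          ∀ σ, FreeFermion.Represents (A.output w) σ →
            FreeFermion.schattenOneNorm (σ - ψ) ≤ ε} := by
  have : NeZero n := ⟨by omega⟩
  have hn' : (1 : ℝ) ≤ n := by exact_mod_cast hn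
  have hε0 := hε.1
  have hratio : 4 ≤ 4 * (n : ℝ) ^ 2 / δ := by
    rw [le_div_iff₀ hδ.1]
    nlinarith [hδ.2]
  have hL : 1 ≤ Real.log (4 * (n : ℝ) ^ 2 / δ) := by
    rw [Real.le_log_iff_exp_le (by linarith)]
    linarith [Real.exp_one_lt_d9]
  have hK := FreeFermion.copies_per_class hn hε hL
  set L := Real.log (4 * (n : ℝ) ^ 2 / δ) with hLdef
  set N := ⌈32 * ((n : ℝ) ^ 3 / ε ^ 2) * L⌉₊
  have hc : (0 : ℝ) < 4 * n * (2 * n - 1) := by nlinarith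
  refine ⟨FreeFermion.covLearner n N (ε ^ 2 / 2), fun ψ hψ => ?_⟩
  obtain ⟨Q, hQ, U, hU, rfl⟩ := hψ.exists_eq
  -- The entrywise accuracy is chosen so that the `2n (2n - 1)` off-diagonal entries contribute at
  -- most `ε² / 2` in total.
  have hη : √(ε ^ 2 / (4 * n * (2 * n - 1))) ^ 2 = ε ^ 2 / (4 * n * (2 * n - 1)) :=
    Real.sq_sqrt (by positivity)
  refine FreeFermion.covLearner_prob N
    (η := √(ε ^ 2 / (4 * n * (2 * n - 1)))) (Real.sqrt_nonneg _) ?_ ?_ ?_ hU _ fun w hw => ?_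
  · rw [hη]
    apply le_of_eq
    have : (2 * n - 1 : ℝ) ≠ 0 := by linarith
    have : (n : ℝ) ≠ 0 := by linarith
    have : (n * 2 - 1 : ℝ) ≠ 0 := by linarith
    field_simp
    ring
  · have : (0 : ℝ) < 8 * n * (2 * n - 1) * L / ε ^ 2 :=
      div_pos (mul_pos (by linarith) (by linarith)) (by positivity)
    exact_mod_cast this.trans_le hK
  · rw [hη]
    -- The Hoeffding exponent reaches `L`, and `4n² exp (-L) = δ`.
    have h1 : L ≤ ((N / (n * 2) : ℕ) : ℝ) * (ε ^ 2 / (4 * n * (2 * n - 1))) / 2 := by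
      have h2 := mul_le_mul_of_nonneg_right hK
        (show 0 ≤ ε ^ 2 / (4 * n * (2 * n - 1)) / 2 by positivity)
      have h3 : 8 * n * (2 * n - 1) * L / ε ^ 2 * (ε ^ 2 / (4 * n * (2 * n - 1)) / 2) = L := by
        have : (2 * n - 1 : ℝ) ≠ 0 := by linarith
        have : (n : ℝ) ≠ 0 := by linarith
        have : (n * 2 - 1 : ℝ) ≠ 0 := by linarith
        field_simp
        ring
      linarith
    calc 4 * (n : ℝ) ^ 2 * Real.exp _ ≤ 4 * (n : ℝ) ^ 2 * Real.exp (-L) := by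
          refine mul_le_mul_of_nonneg_left (Real.exp_le_exp.2 (neg_le_neg h1)) (by positivity)
      _ = δ := by
          have : (n : ℝ) ≠ 0 := by linarith
          have := hδ.1.ne'
          rw [Real.exp_neg, hLdef, Real.exp_log (by linarith)]
          field_simp
  · obtain ⟨⟨V, hV⟩, hclose⟩ := FreeFermion.roundCov_spec hQ hU hw
    refine ⟨⟨_, V, hV, rfl⟩, ?_⟩
    -- The distance bound involves only correlation matrices, so it applies to any unitary
    -- implementing the output matrix.
    rintro σ ⟨V', hV', rfl⟩
    refine FreeFermion.schattenOneNorm_sub_le hQ hU (Subtype.property _) hV' hε0.le ?_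
    have htri : ∀ x y z : ℝ, (y - z) ^ 2 ≤ 2 * (x - y) ^ 2 + 2 * (x - z) ^ 2 := fun x y z => by
      nlinarith [sq_nonneg ((x - y) + (x - z))]
    refine (Finset.sum_le_sum fun μ _ => Finset.sum_le_sum fun ν _ =>
      htri (FreeFermion.empiricalCov w μ ν) _ _).trans ?_
    simp only [Finset.sum_add_distrib, ← Finset.mul_sum]
    have e : (FreeFermion.covLearner n N (ε ^ 2 / 2)).output w =
        FreeFermion.roundCov (ε ^ 2 / 2) (FreeFermion.empiricalCov w) := rfl
    rw [e]
    linarith [hw, hclose]
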